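/- Conventions. Let $A\subset\mathbb Z^d$ be a finite set that generates $\mathbb Z^d$ as an affine lattice. The $A$-resultant $R_A(f_0,\dots,f_d)$ is the polynomial with integer coefficients, in the coefficients of $d+1$ Laurent polynomials $f_0,\dots,f_d$ with exponents in $A$, defined up to sign as follows: let $\mathscr Z\subset(\mathbb C^A)^{d+1}$ be the set of systems having a common zero in $(\mathbb C^*)^d$; if the Zariski closure $\overline{\mathscr Z}$ is a hypersurface, $R_A$ is the irreducible integer polynomial whose zero set is $\overline{\mathscr Z}$, and otherwise $R_A=1$. For $f=\sum_{a\in A}z_a x^a$ the principal $A$-determinant is $E_A(f)=R_A\big(f,x_1\tfrac{\partial f}{\partial x_1},\dots,x_d\tfrac{\partial f}{\partial x_d}\big)$, a polynomial in the $z_a$ determined up to sign. For an arbitrary non-empty finite set $A\subset\mathbb Z^n$, $E_A$ is defined by writing $A$ in affine coordinates of the affine lattice it generates, that is, $E_A:=E_{A'}$ for any injective affine map $T:\mathbb Z^d\to\mathbb Z^n$ and any $A'$ generating $\mathbb Z^d$ affinely with $T(A')=A$ (coefficients at $a'$ and $T(a')$ being identified). Let $\Gamma$ be a finite connected multigraph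 (parallel edges and self-loops are allowed) with edge set $E(\Gamma)$. Its number of loops is its first Betti number $|E(\Gamma)|-|V(\Gamma)|+1$, and its first Symanzik polynomial is $\mathcal U_\Gamma=\sum_{T}\prod_{e\in E(\Gamma)\setminus T}x_e$, where $T$ runs over all spanning trees. The $L$-loop banana graph consists of two distinct vertices and $L+1$ edges joining them. Denote by $A_{\mathcal U}$ the support of $\mathcal U=\mathcal U_\Gamma$, and by $E_{A_{\mathcal U}}(\mathcal U)$ the value of the principal $A_{\mathcal U}$-determinant at the coefficients of $\mathcal U$. Lemma. For every one-loop graph and every $L$-loop banana graph $\Gamma$, \[E_{A_{\mathcal U}}(\mathcal U)=1\] (up to the choice of sign in the definition of $E_{A_{\mathcal U}}$: one choice of the sign gives the value $1$, and every choice gives $\pm1$). -/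

import Mathlib

open scoped Graph

noncomputable section

/-! ### Resultants of a point configuration and principal determinants

A finite configuration of lattice points is given as a family `a : κ → ι → ℤ`, the index `s : κ`
enumerating its points `a s` (below always without repetition).  The coefficient space `ℂ^A` is
then `κ → ℂ`, and a polynomial in the coefficients `z_s` is an element of `MvPolynomial κ ℤ`. -/

/-- The Laurent polynomial `∑ s, c s * x ^ a s` evaluated at a point `x` of the torus `(ℂ^*)^d`. -/
def laurentEval {κ : Type*} [Fintype κ] {d : ℕ} (a : κ → Fin d → ℤ) (c : κ → ℂ)
    (x : Fin d → ℂˣ) : ℂ :=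
  ∑ s, c s * ((∏ j, x j ^ a s j : ℂˣ) : ℂ)

/-- The set of coefficients of systems `(f_0, …, f_d)` of `d + 1` Laurent polynomials with exponents
in `A` that have a common zero in the torus `(ℂ^*)^d`. -/
def resultantLocus {κ : Type*} [Fintype κ] {d : ℕ} (a : κ → Fin d → ℤ) :
    Set (Fin (d + 1) × κ → ℂ) :=
  {c | ∃ x : Fin d → ℂˣ, ∀ i, laurentEval a (fun s => c (i, s)) x = 0}

/-- The Zariski closure of a subset of affine space over `ℂ`. -/
def zariskiClosure {τ : Type*} (S : Set (τ → ℂ)) : Set (τ → ℂ) :=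
  MvPolynomial.zeroLocus ℂ (MvPolynomial.vanishingIdeal ℂ S)

/-- A subset of affine space that is the zero set of one non-constant polynomial. -/
def IsHypersurface {τ : Type*} (V : Set (τ → ℂ)) : Prop :=
  ∃ p : MvPolynomial τ ℂ, 0 < p.totalDegree ∧ V = {c | MvPolynomial.aeval c p = 0}

/-- `R` is an `A`-resultant `R_A(f_0, …, f_d)` of the configuration `A` in `ℤ^d`: the irreducible
integer polynomial that defines the Zariski closure of `resultantLocus a` if this closure is a
hypersurface, and `1` otherwise, in both cases up to a sign. -/
def IsAResultant {κ : Type*} [Fintype κ] {d : ℕ} (a : κ → Fin d → ℤ)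
    (R : MvPolynomial (Fin (d + 1) × κ) ℤ) : Prop :=
  (IsHypersurface (zariskiClosure (resultantLocus a)) →
      Irreducible R ∧
        zariskiClosure (resultantLocus a) = {c | MvPolynomial.aeval c R = 0}) ∧
    (¬ IsHypersurface (zariskiClosure (resultantLocus a)) → R = 1 ∨ R = -1)

/-- The coefficients, as polynomials in `z`, of the system
`(f, x_1 ∂f/∂x_1, …, x_d ∂f/∂x_d)` for the generic `f = ∑ s, z_s x ^ a s`:
the coefficient of `x ^ a s` is `z_s` in `f`, and `(a s)_j z_s` in `x_j ∂f/∂x_j`. -/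
def logDerivSystem {κ : Type*} {d : ℕ} (a : κ → Fin d → ℤ) :
    Fin (d + 1) × κ → MvPolynomial κ ℤ :=
  fun p => MvPolynomial.C ((Fin.cons 1 (a p.2) : Fin (d + 1) → ℤ) p.1) * MvPolynomial.X p.2

/-- `E` is a principal `A`-determinant `R_A(f, x_1 ∂f/∂x_1, …, x_d ∂f/∂x_d)` of a configuration
`A ⊆ ℤ^d` that generates `ℤ^d` as an affine lattice. -/
def IsPrincipalADetFull {κ : Type*} [Fintype κ] {d : ℕ} (a : κ → Fin d → ℤ)
    (E : MvPolynomial κ ℤ) : Prop :=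
  affineSpan ℤ (Set.range a) = ⊤ ∧
    ∃ R, IsAResultant a R ∧ E = MvPolynomial.aeval (logDerivSystem a) R

/-- `E` is a principal `A`-determinant of an arbitrary finite configuration `A ⊆ ℤ^ι`: `A` is
written in affine coordinates of the affine lattice that it generates, i.e. as the image of a
configuration `a'` generating `ℤ^d` under an injective affine map `ℤ^d → ℤ^ι`. -/
def IsPrincipalADet {κ ι : Type*} [Fintype κ] (a : κ → ι → ℤ) (E : MvPolynomial κ ℤ) : Prop :=
  ∃ (d : ℕ) (T : (Fin d → ℤ) →ᵃ[ℤ] (ι → ℤ)) (a' : κ → Fin d → ℤ),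
    Function.Injective T ∧ (∀ s, T (a' s) = a s) ∧ IsPrincipalADetFull a' E

/-- The support of a polynomial, as a configuration of lattice points. -/
def supportConfig {ι : Type*} (f : MvPolynomial ι ℂ) : f.support → ι → ℤ :=
  fun m e => ((m : ι →₀ ℕ) e : ℤ)

/-- The value of a polynomial `E` in the coefficients at the coefficients of `f`. -/
def evalAtCoeffs {ι : Type*} (f : MvPolynomial ι ℂ) (E : MvPolynomial f.support ℤ) : ℂ :=
  MvPolynomial.aeval (fun m : f.support => f.coeff (m : ι →₀ ℕ)) E

/-! ### Feynman graphs and the first Symanzik polynomial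

A Feynman graph is a finite connected multigraph; parallel edges and edges from a vertex to itself
are allowed, and external legs are omitted. -/

/-- Any two vertices are joined by a path, and there is a vertex. -/
def IsConnectedGraph {α β : Type*} (G : Graph α β) : Prop :=
  V(G).Nonempty ∧ ∀ u ∈ V(G), ∀ v ∈ V(G), Relation.ReflTransGen G.Adj u v

/-- There is no cycle: deleting an edge always disconnects its ends. -/
def IsAcyclicGraph {α β : Type*} (G : Graph α β) : Prop :=
  ∀ e u v, G.IsLink e u v → ¬ Relation.ReflTransGen (G.deleteEdges {e}).Adj u v

/-- The set of edges `T` forms a spanning tree (`G.restrict T` has all vertices of `G`). -/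
def IsSpanningTree {α β : Type*} (G : Graph α β) (T : Set β) : Prop :=
  T ⊆ E(G) ∧ IsConnectedGraph (G.restrict T) ∧ IsAcyclicGraph (G.restrict T)

/-- A connected multigraph with finitely many vertices and edges. -/
def IsFeynmanGraph {α β : Type*} (G : Graph α β) : Prop :=
  V(G).Finite ∧ E(G).Finite ∧ IsConnectedGraph G

/-- The number of loops (first Betti number) of a finite connected graph. -/
def loopNumber {α β : Type*} (G : Graph α β) : ℤ :=
  (E(G).ncard : ℤ) - (V(G).ncard : ℤ) + 1

open Classical in
/-- The first Symanzik polynomial `∑_T ∏_{e ∉ T} x_e`, the sum running over all spanning trees. -/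
def firstSymanzik {α β : Type*} [Fintype β] (G : Graph α β) : MvPolynomial β ℂ :=
  ∑ T : Finset β with IsSpanningTree G (T : Set β),
    ∏ e : β with e ∈ E(G) ∧ e ∉ T, MvPolynomial.X e

/-- `E_{A_f}(f) = 1`, for the support `A_f` of `f`.  Principal determinants are determined up to a
sign, so one of them takes the value `1` at the coefficients of `f`, and every one `1` or `-1`. -/
def PrincipalADetEqOne {ι : Type*} (f : MvPolynomial ι ℂ) : Prop :=
  (∃ E, IsPrincipalADet (supportConfig f) E ∧ evalAtCoeffs f E = 1) ∧
    ∀ E, IsPrincipalADet (supportConfig f) E → evalAtCoeffs f E = 1 ∨ evalAtCoeffs f E = -1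

end

/-! In both families all coefficients of $\mathcal U$ are $1$ and its support is affinely
independent. A spanning tree of a one-loop graph omits exactly one edge, so $\mathcal U$ is a sum of
distinct variables. A spanning tree of a banana graph is a single edge, so the exponents are the
all-ones vector on the edges minus a unit vector.

In coordinates of the lattice they generate, affinely independent points become $d+1$ points of
$\mathbb Z^d$ forming a unimodular simplex. Their monomials then take arbitrary nonzero values on
the torus up to a common factor (`exists_torus_point`), so a system $(f_0,\dots,f_d)$ is essentially
a square linear system. Its resultant is the determinant of the coefficients up to sign
(`isAResultant_iff`): this determinant is irreducible and cuts out the closure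
(`zariskiClosure_resultantLocus`). For $(f, x_1\partial_1 f,\dots,x_d\partial_d f)$ with all $z_a=1$
the coefficient matrix is the homogeneous matrix of the simplex, of determinant $\pm1$. -/

noncomputable section

/-! ### Irreducibility of the generic determinant and uniqueness up to sign -/

open MvPolynomial in
/-- The determinant of a square matrix of distinct variables is irreducible. -/
theorem irreducible_det_of_X {R τ : Type*} [CommRing R] [IsDomain R] (n : ℕ)
    (f : Fin (n + 1) → Fin (n + 1) → τ) (hf : Function.Injective2 f) :
    Irreducible (Matrix.of fun i j => (X (f i j) : MvPolynomial τ R)).det := by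
  classical
  induction n with
  | zero =>
    have := irreducible_mul_X_add (1 : MvPolynomial τ R) 0 (f 0 0) one_ne_zero (by simp)
      (by simp) isRelPrime_one_left
    simpa using this
  | succ n ih =>
    set M : Matrix (Fin (n + 2)) (Fin (n + 2)) (MvPolynomial τ R) :=
      Matrix.of fun i j => X (f i j) with hM
    set m := (M.submatrix Fin.succ (Fin.succAbove 0)).det with hm
    set b := ∑ j : Fin (n + 1), (-1) ^ ((j.succ : Fin (n + 2)) : ℕ) * M 0 j.succ *
      (M.submatrix Fin.succ (Fin.succAbove j.succ)).det with hb
    -- Laplace expansion makes the determinant linear in one corner variable, so irreducibility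
    -- reduces to coprimality of `m` and `b`.
    have hdet : M.det = m * X (f 0 0) + b := by
      rw [Matrix.det_succ_row_zero, Fin.sum_univ_succ, hm, hb]
      simp [hM, mul_comm]
    have hmirr : Irreducible m :=
      ih (fun i j => f i.succ (Fin.succAbove 0 j)) fun i i' j j' h => by
        obtain ⟨h1, h2⟩ := hf h
        exact ⟨Fin.succ_injective _ h1, Fin.succAbove_right_injective h2⟩
    have hX : ∀ i j, (i ≠ 0 ∨ j ≠ 0) → M i j ∈ supported R ({f 0 0}ᶜ : Set τ) := by
      intro i j hij
      refine X_mem_supported.2 fun h => ?_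
      obtain ⟨h1, h2⟩ := hf h
      exact hij.elim (fun h => h h1) (fun h => h h2)
    have hminor : ∀ k : Fin (n + 2) , (M.submatrix Fin.succ (Fin.succAbove k)).det ∈
        supported R ({f 0 0}ᶜ : Set τ) := by
      intro k
      rw [Matrix.det_apply]
      refine Subalgebra.sum_mem _ fun σ _ => ?_
      rw [Units.smul_def]
      exact zsmul_mem (Subalgebra.prod_mem _ fun i _ => hX _ _ (.inl (Fin.succ_ne_zero _))) _
    have key : ∀ p ∈ supported R ({f 0 0}ᶜ : Set τ), f 0 0 ∉ p.vars := fun p hp h =>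
      (mem_supported.1 hp) h rfl
    rw [hdet]
    refine irreducible_mul_X_add m b (f 0 0) hmirr.ne_zero (key _ (hminor 0)) (key _ ?_) ?_
    · refine Subalgebra.sum_mem _ fun j _ => Subalgebra.mul_mem _ (Subalgebra.mul_mem _ ?_
        (hX _ _ (.inr (Fin.succ_ne_zero _)))) (hminor _)
      exact Subalgebra.pow_mem _ (Subalgebra.neg_mem _ (Subalgebra.one_mem _)) _
    · refine hmirr.isRelPrime_iff_not_dvd.2 fun hdvd => ?_
      -- At this transposition matrix the determinant is $-1$ but the corner minor `m` vanishes, so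
      -- `m` cannot divide `b`.
      let P : Matrix (Fin (n + 2)) (Fin (n + 2)) R :=
        (Equiv.swap (0 : Fin (n + 2)) 1).permMatrix R
      have hP : ∃ z : τ → R, ∀ i j, z (f i j) = P i j := by
        have hu : Function.Injective (fun p : Fin (n + 2) × Fin (n + 2) => f p.1 p.2) := by
          rintro ⟨i, j⟩ ⟨i', j'⟩ h
          exact Prod.ext_iff.2 (hf h)
        exact ⟨Function.extend (fun p : Fin (n + 2) × Fin (n + 2) => f p.1 p.2)
          (fun p => P p.1 p.2) 0, fun i j => hu.extend_apply _ _ (i, j)⟩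
      obtain ⟨z, hz⟩ := hP
      have hMz : (eval z).mapMatrix M = P := by
        ext i j
        simp [hM, hz]
      have h1 : eval z M.det = -1 := by
        rw [RingHom.map_det, hMz, Matrix.det_permutation, Equiv.Perm.sign_swap (by simp)]
        simp
      have h2 : eval z m = 0 := by
        rw [hm, RingHom.map_det]
        refine Matrix.det_eq_zero_of_row_eq_zero 0 fun j => ?_
        have : P 1 j.succ = 0 := by
          simp [P, Equiv.Perm.permMatrix, PEquiv.toMatrix_apply, (Fin.succ_ne_zero j).symm]
        simpa [← this, hM] using hz 1 j.succ
      have h3 : eval z b = 0 := by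
        obtain ⟨q, hq⟩ := hdvd
        rw [hq, map_mul, h2, zero_mul]
      rw [hdet, map_add, map_mul, h2, h3] at h1
      simp at h1

open MvPolynomial in
/-- Divisibility by a prime polynomial without constant term descends from `ℚ` to `ℤ`. -/
theorem dvd_of_map_dvd_map {τ : Type*} {D R : MvPolynomial τ ℤ} (hD : Prime D)
    (h0 : constantCoeff D = 0) (h : map (Int.castRingHom ℚ) D ∣ map (Int.castRingHom ℚ) R) :
    D ∣ R := by
  let _ : Algebra (MvPolynomial τ ℤ) (MvPolynomial τ ℚ) := algebraMvPolynomial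
  obtain ⟨g, hg⟩ := h
  obtain ⟨⟨q, ⟨N, hN⟩⟩, hq⟩ := IsLocalization.surj
    ((nonZeroDivisors ℤ).map (C : ℤ →+* MvPolynomial τ ℤ)) g
  obtain ⟨N, hN0, rfl⟩ := hN
  have hinj : Function.Injective (map (Int.castRingHom ℚ) : MvPolynomial τ ℤ →+* _) :=
    map_injective _ Int.cast_injective
  have e1 : R * C N = D * q := by
    apply hinj
    have hq' : g * map (Int.castRingHom ℚ) (C N) = map (Int.castRingHom ℚ) q := hq
    rw [map_mul, map_mul, hg, mul_assoc, hq']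
  -- After clearing denominators `D` divides `R * C N`. It cannot divide the nonzero constant `N`,
  -- since every multiple of `D` has zero constant term.
  refine (hD.dvd_or_dvd (Dvd.intro _ e1.symm)).resolve_right ?_
  rintro ⟨r, hr⟩
  have := congrArg constantCoeff hr
  rw [map_mul, h0, zero_mul, constantCoeff_C] at this
  exact nonZeroDivisors.ne_zero hN0 this

open MvPolynomial in
/-- An irreducible integer polynomial that vanishes over `ℂ` on the zeros of `D` is `± D`,
if `D` is irreducible over `ℤ` and `ℚ` and has no constant term. -/
theorem eq_or_eq_neg_of_zeros {τ : Type*} [Finite τ] {D R : MvPolynomial τ ℤ}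
    (hD : Irreducible D) (hDQ : Irreducible (map (Int.castRingHom ℚ) D))
    (h0 : constantCoeff D = 0) (hR : Irreducible R)
    (h : ∀ c : τ → ℂ, aeval c D = 0 → aeval c R = 0) : R = D ∨ R = -D := by
  have hmap : ∀ (c : τ → ℂ) (p : MvPolynomial τ ℤ),
      aeval c (map (Int.castRingHom ℚ) p) = aeval c p := fun c p =>
    aeval_map_algebraMap ℚ c p
  have hvan : map (Int.castRingHom ℚ) R ∈
      vanishingIdeal ℚ (zeroLocus ℂ (Ideal.span {map (Int.castRingHom ℚ) D})) := by
    intro c hc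
    rw [hmap]
    refine h c ?_
    rw [← hmap]
    exact hc _ (Ideal.mem_span_singleton_self _)
  -- Nullstellensatz for polynomials over `ℚ` with zeros taken in `ℂ`.
  rw [vanishingIdeal_zeroLocus_eq_radical] at hvan
  obtain ⟨n, hn⟩ := hvan
  have hdvd : D ∣ R := dvd_of_map_dvd_map hD.prime h0
    (hDQ.prime.dvd_of_dvd_pow (Ideal.mem_span_singleton.1 hn))
  obtain ⟨u, hu⟩ := hD.associated_of_dvd hR hdvd
  obtain ⟨v, hv, hvu⟩ := (MvPolynomial.isUnit_iff_eq_C_of_isReduced).1 u.isUnit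
  rcases Int.isUnit_iff.1 hv with rfl | rfl
  · left; rw [← hu, hvu]; simp
  · right; rw [← hu, hvu]; simp

/-! ### Unimodular simplices and their resultants -/

/-- The columns of this matrix are the points of a configuration with a coordinate `1` prepended. -/
def homogeneousMatrix {κ : Type*} {d : ℕ} (a : κ → Fin d → ℤ) (e : Fin (d + 1) ≃ κ) :
    Matrix (Fin (d + 1)) (Fin (d + 1)) ℤ :=
  Matrix.of fun i j => (Fin.cons 1 (a (e j)) : Fin (d + 1) → ℤ) i

/-- The determinant of the coefficients of a generic system, for a configuration of `d + 1` points
in dimension `d`. -/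
def genericDet {κ : Type*} {d : ℕ} (e : Fin (d + 1) ≃ κ) (R : Type*) [CommRing R] :
    MvPolynomial (Fin (d + 1) × κ) R :=
  (Matrix.of fun i j => MvPolynomial.X (i, e j)).det

section
variable {κ : Type*} {d : ℕ}

theorem irreducible_genericDet (e : Fin (d + 1) ≃ κ) (R : Type*) [CommRing R] [IsDomain R] :
    Irreducible (genericDet e R) :=
  irreducible_det_of_X d (fun i j => (i, e j)) fun i i' j j' h => by simpa using h

theorem aeval_genericDet (e : Fin (d + 1) ≃ κ) {R S : Type*} [CommRing R] [CommRing S]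
    [Algebra R S] (c : Fin (d + 1) × κ → S) :
    MvPolynomial.aeval c (genericDet e R) = (Matrix.of fun i j => c (i, e j)).det := by
  rw [genericDet, AlgHom.map_det]
  congr 1
  ext i j
  simp

theorem constantCoeff_genericDet (e : Fin (d + 1) ≃ κ) :
    MvPolynomial.constantCoeff (genericDet e ℤ) = 0 := by
  rw [genericDet, RingHom.map_det]
  exact Matrix.det_eq_zero_of_row_eq_zero 0 fun j => by simp

theorem map_genericDet (e : Fin (d + 1) ≃ κ) {R S : Type*} [CommRing R] [CommRing S] (φ : R →+* S) :
    MvPolynomial.map φ (genericDet e R) = genericDet e S := by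
  rw [genericDet, genericDet, RingHom.map_det]
  congr 1
  ext i j
  simp

/-- The homogeneous coordinates of an affine basis of `ℤ^d` form a unimodular matrix. -/
theorem exists_isUnit_det_homogeneousMatrix [Fintype κ] {a : κ → Fin d → ℤ}
    (ha : AffineIndependent ℤ a) (hs : affineSpan ℤ (Set.range a) = ⊤) :
    ∃ e : Fin (d + 1) ≃ κ, IsUnit (homogeneousMatrix a e).det := by
  classical
  let b : AffineBasis κ ℤ (Fin d → ℤ) := ⟨a, ha, hs⟩
  have hb : ∀ s, b s = a s := fun _ => rfl
  obtain ⟨s₀⟩ := b.nonempty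
  have hcard : Fintype.card κ = d + 1 := by
    have h1 := Module.finrank_eq_card_basis (b.basisOf s₀)
    have h2 : 0 < Fintype.card κ := Fintype.card_pos_iff.2 ⟨s₀⟩
    rw [Module.finrank_fin_fun, Fintype.card_subtype_compl, Fintype.card_subtype_eq] at h1
    omega
  let e := (Fintype.equivFinOfCardEq hcard).symm
  refine ⟨e, ?_⟩
  -- Row `s` lists the constant term and the linear coefficients of the barycentric coordinate of `e
  -- s`; duality with the points is `N * M = 1`.
  let N : Matrix (Fin (d + 1)) (Fin (d + 1)) ℤ := Matrix.of fun s i =>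
    (Fin.cons (b.coord (e s) 0) (fun k => (b.coord (e s)).linear fun l => if k = l then 1 else 0) :
      Fin (d + 1) → ℤ) i
  have hNM : N * homogeneousMatrix a e = 1 := by
    ext s j
    have h1 : b.coord (e s) (a (e j)) = if s = j then 1 else 0 := by
      rw [← hb, b.coord_apply]
      simp
    rw [Matrix.mul_apply, Fin.sum_univ_succ, Matrix.one_apply, ← h1]
    have h2 := congrFun (AffineMap.decomp (b.coord (e s))) (a (e j))
    rw [h2, Pi.add_apply, LinearMap.pi_apply_eq_sum_univ _ (a (e j))]
    simp [N, homogeneousMatrix, add_comm, mul_comm]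
  exact (Matrix.isUnit_iff_isUnit_det _).1 (IsUnit.of_mul_eq_one_right _ hNM)

theorem prod_zpow_eq_zpow_sum {G ι : Type*} [CommGroup G] (g : G) (s : Finset ι) (n : ι → ℤ) :
    ∏ i ∈ s, g ^ n i = g ^ ∑ i ∈ s, n i := by
  classical
  induction s using Finset.induction_on with
  | empty => simp
  | insert i s hi ih => rw [Finset.prod_insert hi, Finset.sum_insert hi, zpow_add, ih]

/-- A unimodular simplex parametrizes the torus of its coefficient space, up to a common factor. -/
theorem exists_torus_point {a : κ → Fin d → ℤ} {e : Fin (d + 1) ≃ κ}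
    (h : IsUnit (homogeneousMatrix a e).det) {G : Type*} [CommGroup G] (y : κ → G) :
    ∃ (l : G) (x : Fin d → G), ∀ s, y s = l * ∏ j, x j ^ a s j := by
  let M := homogeneousMatrix a e
  have hNM : M⁻¹ * M = 1 := Matrix.nonsing_inv_mul _ h
  -- Solves the monomial equations $w^M = y$ with the integral inverse matrix. The row of ones in
  -- $M$ turns `w 0` into the common factor.
  let w : Fin (d + 1) → G := fun i => ∏ k, y (e k) ^ M⁻¹ k i
  have hw : ∀ j, ∏ i, w i ^ M i j = y (e j) := by
    intro j
    have h1 : ∀ i, w i ^ M i j = ∏ k, y (e k) ^ (M⁻¹ k i * M i j) := fun i => by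
      simp only [w, ← Finset.prod_zpow, zpow_mul]
    have h2 : ∀ k, ∏ i, y (e k) ^ (M⁻¹ k i * M i j) = y (e k) ^ ((1 : Matrix _ _ ℤ) k j) :=
      fun k => by
        rw [← hNM, Matrix.mul_apply, prod_zpow_eq_zpow_sum]
    simp_rw [h1]
    rw [Finset.prod_comm]
    simp_rw [h2, Matrix.one_apply]
    rw [Finset.prod_eq_single j] <;> simp +contextual
  refine ⟨w 0, fun j => w j.succ, fun s => ?_⟩
  have := hw (e.symm s)
  rw [Fin.prod_univ_succ] at this
  simpa [M, homogeneousMatrix] using this.symm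

theorem aeval_one_logDerivSystem_genericDet (a : κ → Fin d → ℤ) (e : Fin (d + 1) ≃ κ) :
    MvPolynomial.aeval (fun _ => (1 : ℂ)) (MvPolynomial.aeval (logDerivSystem a) (genericDet e ℤ)) =
      (((homogeneousMatrix a e).det : ℤ) : ℂ) := by
  rw [aeval_genericDet, AlgHom.map_det, ← eq_intCast (Int.castRingHom ℂ), RingHom.map_det]
  congr 1
  ext i j
  simp [logDerivSystem, homogeneousMatrix]

variable [Fintype κ]

theorem laurentEval_eq_sum (a : κ → Fin d → ℤ) (c : κ → ℂ) (x : Fin d → ℂˣ) {l : ℂˣ} {y : κ → ℂˣ}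
    (h : ∀ s, y s = l * ∏ j, x j ^ a s j) : ∑ s, c s * (y s : ℂ) = l * laurentEval a c x := by
  rw [laurentEval, Finset.mul_sum]
  refine Finset.sum_congr rfl fun s _ => ?_
  rw [h, Units.val_mul]
  ring

theorem det_eq_zero_of_mem_resultantLocus (a : κ → Fin d → ℤ) (e : Fin (d + 1) ≃ κ)
    {c : Fin (d + 1) × κ → ℂ} (hc : c ∈ resultantLocus a) :
    (Matrix.of fun i j => c (i, e j)).det = 0 := by
  obtain ⟨x, hx⟩ := hc
  refine Matrix.exists_mulVec_eq_zero_iff.1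
    ⟨fun j => ((∏ k, x k ^ a (e j) k : ℂˣ) : ℂ), fun h => ?_, ?_⟩
  · exact (∏ k, x k ^ a (e 0) k : ℂˣ).ne_zero (congrFun h 0)
  · ext i
    rw [Pi.zero_apply, ← hx i, laurentEval, ← e.sum_comp]
    rfl

/-- A system with a common zero `y ≠ 0` in the linear coordinates lies in the closure of the systems
with a common zero in the torus. -/
theorem mem_zariskiClosure_resultantLocus {a : κ → Fin d → ℤ} {e : Fin (d + 1) ≃ κ}
    (h : IsUnit (homogeneousMatrix a e).det) {c : Fin (d + 1) × κ → ℂ} {y : κ → ℂ} {s₀ : κ}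
    (hs₀ : y s₀ ≠ 0) (hc : ∀ i, ∑ s, c (i, s) * y s = 0) :
    c ∈ zariskiClosure (resultantLocus a) := by
  classical
  intro p hp
  -- The zero `y` is moved along a line by adding `t` to every coordinate except `s₀`; subtracting
  -- `t * r` from the coefficients at `s₀` keeps it a zero of the system.
  let r : Fin (d + 1) → ℂ := fun i => (∑ s ∈ Finset.univ.erase s₀, c (i, s)) / y s₀
  let C : Fin (d + 1) × κ → Polynomial ℂ := fun v =>
    Polynomial.C (c v) - if v.2 = s₀ then Polynomial.X * Polynomial.C (r v.1) else 0
  let q : Polynomial ℂ := MvPolynomial.aeval C p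
  have hq : ∀ t, q.eval t = MvPolynomial.aeval (fun v => (C v).eval t) p := by
    intro t
    have := MvPolynomial.comp_aeval_apply C (Polynomial.aeval t : Polynomial ℂ →ₐ[ℂ] ℂ) p
    simpa only [Polynomial.coe_aeval_eq_eval] using this
  let B : Set ℂ := Set.range fun s => -y s
  -- Outside the finite set `B` the moved zero has no zero coordinate and comes from a torus point,
  -- so `q` has infinitely many roots; its value at `t = 0` is that of `p` at `c`.
  have hroot : ∀ t ∉ B, q.eval t = 0 := by
    intro t ht
    rw [hq]
    refine hp _ ?_
    let z : κ → ℂ := fun s => y s + if s = s₀ then 0 else t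
    have hz : ∀ s, z s ≠ 0 := by
      intro s hs
      by_cases hss : s = s₀
      · subst hss
        exact hs₀ (by simpa [z] using hs)
      · refine ht ⟨s, ?_⟩
        simp only [z, hss, if_false] at hs
        linear_combination -hs
    obtain ⟨l, x, hx⟩ := exists_torus_point h fun s => Units.mk0 (z s) (hz s)
    refine ⟨x, fun i => ?_⟩
    have hsum := laurentEval_eq_sum a (fun s => (C (i, s)).eval t) x hx
    refine (mul_eq_zero.1 (hsum.symm.trans ?_)).resolve_left l.ne_zero
    have hci := hc i
    rw [← Finset.add_sum_erase _ _ (Finset.mem_univ s₀)] at hci ⊢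
    have h1 : ∀ s ∈ Finset.univ.erase s₀, (C (i, s)).eval t * ((Units.mk0 (z s) (hz s) : ℂˣ) : ℂ) =
        c (i, s) * y s + c (i, s) * t := by
      intro s hs
      simp only [C, z, Finset.ne_of_mem_erase hs, if_false, Units.val_mk0, Polynomial.eval_sub,
        Polynomial.eval_C, Polynomial.eval_zero]
      ring
    rw [Finset.sum_congr rfl h1, Finset.sum_add_distrib, ← Finset.sum_mul]
    have h2 : r i * y s₀ = ∑ s ∈ Finset.univ.erase s₀, c (i, s) := div_mul_cancel₀ _ hs₀
    rw [← h2]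
    simp only [C, z, if_true, Units.val_mk0, Polynomial.eval_sub, Polynomial.eval_C,
      Polynomial.eval_mul, Polynomial.eval_X]
    linear_combination hci
  have hq0 : q = 0 := by
    refine Polynomial.eq_zero_of_infinite_isRoot q (Set.Infinite.mono (s := Bᶜ) hroot ?_)
    exact (Set.finite_range _).infinite_compl
  have h0 := hq 0
  rw [hq0, Polynomial.eval_zero] at h0
  have hC0 : (fun v => (C v).eval 0) = c := by
    funext v
    simp only [C]
    split_ifs <;> simp
  rw [h0, hC0]

/-- A common torus zero gives a nonzero kernel vector of the coefficient matrix. Conversely a kernel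
vector may have zero coordinates, hence the closure. -/
theorem zariskiClosure_resultantLocus {a : κ → Fin d → ℤ} {e : Fin (d + 1) ≃ κ}
    (h : IsUnit (homogeneousMatrix a e).det) :
    zariskiClosure (resultantLocus a) = {c | (Matrix.of fun i j => c (i, e j)).det = 0} := by
  ext c
  constructor
  · intro hc
    have := hc (genericDet e ℂ) fun c' hc' => by
      rw [aeval_genericDet]
      exact det_eq_zero_of_mem_resultantLocus a e hc'
    rwa [aeval_genericDet] at this
  · intro hc
    obtain ⟨y, hy0, hy⟩ := Matrix.exists_mulVec_eq_zero_iff.2 hc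
    obtain ⟨j, hj⟩ := Function.ne_iff.1 hy0
    refine mem_zariskiClosure_resultantLocus h (y := fun s => y (e.symm s)) (s₀ := e j)
      (by simpa using hj) fun i => ?_
    rw [← e.sum_comp]
    simpa [Matrix.mulVec, dotProduct] using congrFun hy i

theorem isHypersurface_zariskiClosure {a : κ → Fin d → ℤ} {e : Fin (d + 1) ≃ κ}
    (h : IsUnit (homogeneousMatrix a e).det) :
    IsHypersurface (zariskiClosure (resultantLocus a)) := by
  refine ⟨genericDet e ℂ, Nat.pos_of_ne_zero fun h0 => ?_, ?_⟩
  · rw [MvPolynomial.totalDegree_eq_zero_iff_eq_C] at h0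
    refine (irreducible_genericDet e ℂ).not_isUnit ?_
    rw [h0]
    refine (isUnit_iff_ne_zero.2 fun h1 => ?_).map MvPolynomial.C
    rw [h1, map_zero] at h0
    exact (irreducible_genericDet e ℂ).ne_zero h0
  · rw [zariskiClosure_resultantLocus h]
    simp only [aeval_genericDet]

/-- The resultant of a unimodular simplex is the determinant of the coefficients. -/
theorem isAResultant_iff {a : κ → Fin d → ℤ} {e : Fin (d + 1) ≃ κ}
    (h : IsUnit (homogeneousMatrix a e).det) (R : MvPolynomial (Fin (d + 1) × κ) ℤ) :
    IsAResultant a R ↔ R = genericDet e ℤ ∨ R = -genericDet e ℤ := by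
  have hyp := isHypersurface_zariskiClosure h
  constructor
  · intro hR
    obtain ⟨hirr, hzero⟩ := hR.1 hyp
    refine eq_or_eq_neg_of_zeros (irreducible_genericDet e ℤ) ?_ (constantCoeff_genericDet e) hirr
      fun c hc => ?_
    · rw [map_genericDet]
      exact irreducible_genericDet e ℚ
    · have : c ∈ zariskiClosure (resultantLocus a) := by
        rw [zariskiClosure_resultantLocus h]
        rwa [aeval_genericDet] at hc
      rwa [hzero] at this
  · intro hR
    have hirr : Irreducible R := by
      rcases hR with rfl | rfl
      · exact irreducible_genericDet e ℤ
      · exact (Associated.refl _).neg_left.irreducible_iff.2 (irreducible_genericDet e ℤ)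
    refine ⟨fun _ => ⟨hirr, ?_⟩, fun h => (h hyp).elim⟩
    rw [zariskiClosure_resultantLocus h]
    rcases hR with rfl | rfl <;> simp [aeval_genericDet]

theorem IsPrincipalADetFull.aeval_one {a : κ → Fin d → ℤ} (ha : AffineIndependent ℤ a)
    {E : MvPolynomial κ ℤ} (hE : IsPrincipalADetFull a E) :
    MvPolynomial.aeval (fun _ => (1 : ℂ)) E = 1 ∨
      MvPolynomial.aeval (fun _ => (1 : ℂ)) E = -1 := by
  obtain ⟨hs, R, hR, rfl⟩ := hE
  obtain ⟨e, he⟩ := exists_isUnit_det_homogeneousMatrix ha hs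
  have hdet := aeval_one_logDerivSystem_genericDet a e
  rcases (isAResultant_iff he R).1 hR with rfl | rfl <;>
    rcases Int.isUnit_iff.1 he with h1 | h1 <;> rw [h1] at hdet
  · exact .inl (by rw [hdet, Int.cast_one])
  · exact .inr (by rw [hdet, Int.cast_neg, Int.cast_one])
  · exact .inr (by rw [map_neg, map_neg, hdet, Int.cast_one])
  · exact .inl (by rw [map_neg, map_neg, hdet, Int.cast_neg, Int.cast_one, neg_neg])

theorem exists_isPrincipalADetFull {a : κ → Fin d → ℤ} (ha : AffineIndependent ℤ a)
    (hs : affineSpan ℤ (Set.range a) = ⊤) :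
    ∃ E, IsPrincipalADetFull a E ∧ MvPolynomial.aeval (fun _ => (1 : ℂ)) E = 1 := by
  obtain ⟨e, he⟩ := exists_isUnit_det_homogeneousMatrix ha hs
  have hdet := aeval_one_logDerivSystem_genericDet a e
  rcases Int.isUnit_iff.1 he with h1 | h1
  · exact ⟨_, ⟨hs, _, (isAResultant_iff he _).2 (.inl rfl), rfl⟩, by rw [hdet, h1, Int.cast_one]⟩
  · exact ⟨_, ⟨hs, _, (isAResultant_iff he _).2 (.inr rfl), rfl⟩, by
      rw [map_neg, map_neg, hdet, h1, Int.cast_neg, Int.cast_one, neg_neg]⟩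

/-- A simplex in `ℤ^ι`, written in affine coordinates of the affine lattice that it generates. -/
theorem AffineIndependent.exists_affine_coordinates {ι : Type*} [Nonempty κ] {a : κ → ι → ℤ}
    (ha : AffineIndependent ℤ a) :
    ∃ (d : ℕ) (T : (Fin d → ℤ) →ᵃ[ℤ] (ι → ℤ)) (a' : κ → Fin d → ℤ),
      Function.Injective T ∧ (∀ s, T (a' s) = a s) ∧ affineSpan ℤ (Set.range a') = ⊤ := by
  classical
  obtain ⟨d, hd⟩ := Nat.exists_eq_succ_of_ne_zero (Fintype.card_ne_zero (α := κ))
  let e : κ ≃ Fin (d + 1) := Fintype.equivFinOfCardEq hd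
  let u : Fin d → ι → ℤ := fun j => a (e.symm j.succ) - a (e.symm 0)
  have hu : LinearIndependent ℤ u := by
    have h1 := (affineIndependent_iff_linearIndependent_vsub ℤ a (e.symm 0)).1 ha
    exact h1.comp (fun j : Fin d => ⟨e.symm j.succ, by simp [Fin.succ_ne_zero]⟩)
      fun i j hij => by simpa using hij
  let T : (Fin d → ℤ) →ᵃ[ℤ] (ι → ℤ) :=
    (Fintype.linearCombination ℤ u).toAffineMap + AffineMap.const ℤ _ (a (e.symm 0))
  -- The vertices of the standard simplex, which `T` carries to the given points.
  let p : Fin (d + 1) → Fin d → ℤ := Fin.cons 0 fun j => Pi.single j 1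
  have hT : ∀ v, T v = Fintype.linearCombination ℤ u v + a (e.symm 0) := fun _ => rfl
  refine ⟨d, T, fun s => p (e s), fun v w hvw => ?_, fun s => ?_, ?_⟩
  · rw [hT, hT, add_left_inj] at hvw
    exact hu.fintypeLinearCombination_injective hvw
  · obtain ⟨j, rfl⟩ := e.symm.surjective s
    simp only [hT, e.apply_symm_apply]
    refine Fin.cases ?_ (fun k => ?_) j
    · simp [p]
    · simp [p, u, Fintype.linearCombination_apply_single]
  · have hr : Set.range (fun s => p (e s)) =
        insert 0 (Set.range fun j : Fin d => (Pi.single j 1 : Fin d → ℤ)) := by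
      rw [← Fin.range_cons]
      exact e.surjective.range_comp p
    rw [hr]
    refine SetLike.coe_injective ?_
    rw [affineSpan_insert_zero]
    have := (Pi.basisFun ℤ (Fin d)).span_eq
    have h2 : ⇑(Pi.basisFun ℤ (Fin d)) = fun j : Fin d => (Pi.single j 1 : Fin d → ℤ) := by
      funext j
      simp
    rw [h2] at this
    rw [this]
    rfl

end

/-! ### Polynomials whose support is a simplex -/

/-- If the support of `f` is a simplex and all coefficients are `1`, then `E_A(f) = 1`. -/
theorem principalADetEqOne_of_affineIndependent {ι : Type*} (f : MvPolynomial ι ℂ) (hf : f ≠ 0)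
    (h1 : ∀ m ∈ f.support, f.coeff m = 1) (ha : AffineIndependent ℤ (supportConfig f)) :
    PrincipalADetEqOne f := by
  have : Nonempty f.support := (MvPolynomial.support_nonempty.2 hf).coe_sort
  have hev : ∀ E, evalAtCoeffs f E = MvPolynomial.aeval (fun _ => (1 : ℂ)) E := fun E => by
    rw [evalAtCoeffs]
    congr 2
    funext m
    exact h1 m m.2
  have hind : ∀ {d : ℕ} {T : (Fin d → ℤ) →ᵃ[ℤ] (ι → ℤ)} {a' : f.support → Fin d → ℤ},
      (∀ s, T (a' s) = supportConfig f s) → AffineIndependent ℤ a' := fun {d T a'} h => by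
    refine AffineIndependent.of_comp T ?_
    rwa [show T ∘ a' = supportConfig f from funext h]
  constructor
  · obtain ⟨d, T, a', hT, hTa, hs⟩ := ha.exists_affine_coordinates
    obtain ⟨E, hE, hE1⟩ := exists_isPrincipalADetFull (hind hTa) hs
    exact ⟨E, ⟨d, T, a', hT, hTa, hE⟩, (hev E).trans hE1⟩
  · rintro E ⟨d, T, a', -, hTa, hE⟩
    rw [hev]
    exact hE.aeval_one (hind hTa)

open MvPolynomial in
/-- A sum of distinct monomials whose exponents form a simplex has principal determinant `1`. -/
theorem principalADetEqOne_sum_monomial {ι κ : Type*} (I : Finset κ) (hI : I.Nonempty)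
    (g : κ → ι →₀ ℕ)
    (ha : AffineIndependent ℤ fun (e : I) (x : ι) => ((g e x : ℕ) : ℤ)) :
    PrincipalADetEqOne (∑ e ∈ I, monomial (g e) (1 : ℂ)) := by
  classical
  set f := ∑ e ∈ I, monomial (g e) (1 : ℂ) with hf
  have hinj : ∀ e ∈ I, ∀ e' ∈ I, g e = g e' → e = e' := fun e he e' he' h =>
    
    congrArg Subtype.val (ha.injective (a₁ := ⟨e, he⟩) (a₂ := ⟨e', he'⟩) (by simp [h]))
  have hcoeff : ∀ e ∈ I, f.coeff (g e) = 1 := by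
    intro e he
    rw [hf, coeff_sum, Finset.sum_eq_single e]
    · simp
    · intro e' he' hne
      rw [coeff_monomial, if_neg fun h => hne (hinj _ he' _ he h)]
    · exact fun h => (h he).elim
  have hsupp : ∀ m : f.support, ∃ e : I, g e = m := by
    rintro ⟨m, hm⟩
    by_contra! h
    refine mem_support_iff.1 hm ?_
    rw [hf, coeff_sum]
    refine Finset.sum_eq_zero fun e he => ?_
    rw [coeff_monomial, if_neg (h ⟨e, he⟩)]
  choose k hk using hsupp
  have hkinj : Function.Injective k := fun m m' h => by
    rw [← Subtype.coe_inj, ← hk, ← hk, h]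
  refine principalADetEqOne_of_affineIndependent f ?_ ?_ ?_
  · obtain ⟨e, he⟩ := hI
    exact fun h0 => one_ne_zero ((hcoeff e he).symm.trans (by rw [h0, coeff_zero]))
  · intro m hm
    have hm' := hcoeff _ (k ⟨m, hm⟩).2
    rwa [hk] at hm'
  · convert ha.comp_embedding ⟨k, hkinj⟩ using 1
    funext m x
    simp [supportConfig, hk]

theorem principalADetEqOne_firstSymanzik {α β : Type*} [Fintype β] (G : Graph α β) (I : Finset β)
    (hI : I.Nonempty) (T : β → Finset β)
    (hT : ∀ F : Finset β, IsSpanningTree G (F : Set β) ↔ ∃ e ∈ I, T e = F)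
    (ha : AffineIndependent ℤ fun (e : I) =>
      Set.indicator {x | x ∈ E(G) ∧ x ∉ T e} (1 : β → ℤ)) :
    PrincipalADetEqOne (firstSymanzik G) := by
  classical
  have hinj : Set.InjOn T I := fun e he e' he' h =>
    
    congrArg Subtype.val (ha.injective (a₁ := ⟨e, he⟩) (a₂ := ⟨e', he'⟩) (by simp [h]))
  let g : β → β →₀ ℕ := fun e => ∑ x with x ∈ E(G) ∧ x ∉ T e, Finsupp.single x 1
  have hsum : firstSymanzik G = ∑ e ∈ I, MvPolynomial.monomial (g e) 1 := by
    rw [firstSymanzik]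
    -- The sum is indexed by sets of edges; the finsets `T e` are coerced, and injectivity of `T` on
    -- `I` makes each tree occur once.
    trans ∑ F ∈ I.image fun e => (T e : Set β), ∏ e : β with e ∈ E(G) ∧ e ∉ F,
        (MvPolynomial.X e : MvPolynomial β ℂ)
    · refine Finset.sum_congr ?_ fun F _ => by congr!
      ext F
      obtain ⟨F, rfl⟩ := F.toFinite.exists_finset_coe
      simp [hT]
    rw [Finset.sum_image fun e he e' he' h => hinj he he' (Finset.coe_injective h)]
    refine Finset.sum_congr rfl fun e _ => ?_
    rw [MvPolynomial.monomial_sum_one]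
    simp only [Finset.mem_coe]
    rfl
  rw [hsum]
  refine principalADetEqOne_sum_monomial I hI g ?_
  convert ha using 1
  funext e x
  simp [g, Finsupp.finsetSum_apply, Finsupp.single_apply, Set.indicator_apply]

/-! ### Spanning trees of multigraphs -/

section
variable {α β : Type*}

theorem IsAcyclicGraph.not_isLink_self {H : Graph α β} (h : IsAcyclicGraph H) (e : β) (u : α) :
    ¬ H.IsLink e u u :=
  fun hl => h e u u hl .refl

theorem IsAcyclicGraph.eq_of_isLink {H : Graph α β} (h : IsAcyclicGraph H) {e e' : β} {u v : α}
    (he : H.IsLink e u v) (he' : H.IsLink e' u v) : e = e' := by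
  by_contra hne
  exact h e u v he (.single ⟨e', by simpa [he'] using Ne.symm hne⟩)

theorem IsConnectedGraph.connected_toSimpleGraph {H : Graph α β} (hc : IsConnectedGraph H) :
    H.toSimpleGraph.Connected := by
  have key : ∀ u v, (hu : u ∈ V(H)) → Relation.ReflTransGen H.Adj u v →
      ∃ hv : v ∈ V(H), H.toSimpleGraph.Reachable ⟨u, hu⟩ ⟨v, hv⟩ := by
    intro u v hu h
    induction h with
    | refl => exact ⟨hu, .refl _⟩
    | tail _ hadj ih =>
      rename_i b c _
      obtain ⟨hb, hr⟩ := ih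
      refine ⟨hadj.right_mem, hr.trans ?_⟩
      by_cases hbc : b = c
      · subst hbc
        exact .refl _
      · exact SimpleGraph.Adj.reachable ⟨by simpa using hbc, by simpa using hadj⟩
  have := hc.1.to_subtype
  exact ⟨fun u v => (key u v u.2 (hc.2 u u.2 v v.2)).2⟩

/-- A walk avoiding the simple edge `uv` lifts to a walk avoiding `e`, because any edge with other
ends differs from `e`. -/
theorem IsAcyclicGraph.isAcyclic_toSimpleGraph {H : Graph α β} (h : IsAcyclicGraph H) :
    H.toSimpleGraph.IsAcyclic := by
  rw [SimpleGraph.isAcyclic_iff_forall_adj_isBridge]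
  intro u v huv
  obtain ⟨hne, e, he⟩ : u ≠ v ∧ H.Adj u v := by simpa [Graph.toSimpleGraph] using huv
  rw [SimpleGraph.isBridge_iff, SimpleGraph.reachable_iff_reflTransGen]
  refine fun hr => h e u v he (hr.lift Subtype.val ?_)
  intro x y hxy
  rw [SimpleGraph.deleteEdges_adj] at hxy
  obtain ⟨hxy, hnot⟩ := hxy
  obtain ⟨-, e', he'⟩ : x ≠ y ∧ H.Adj x y := by simpa [Graph.toSimpleGraph] using hxy
  refine ⟨e', ?_⟩
  have : e' ≠ e := by
    rintro rfl
    refine hnot ?_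
    rcases he'.eq_and_eq_or_eq_and_eq he with ⟨h1, h2⟩ | ⟨h1, h2⟩
    · simp [Subtype.ext h1, Subtype.ext h2]
    · simp [Subtype.ext h1, Subtype.ext h2, Sym2.eq_swap]
  simpa [he'] using this

/-- A finite tree has one vertex more than edges. -/
theorem ncard_edgeSet_add_one {H : Graph α β} (hV : V(H).Finite) (hc : IsConnectedGraph H)
    (ha : IsAcyclicGraph H) : E(H).ncard + 1 = V(H).ncard := by
  have := hV.to_subtype
  have htree := (SimpleGraph.isTree_iff_connected_and_card.1
    ⟨hc.connected_toSimpleGraph, ha.isAcyclic_toSimpleGraph⟩).2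
  rw [Nat.card_coe_set_eq, Nat.card_coe_set_eq] at htree
  rw [← htree, add_left_inj]
  have hex : ∀ e ∈ E(H), ∃ u v : V(H), H.IsLink e u v := fun e he => by
    obtain ⟨u, v, h⟩ := H.exists_isLink_of_mem_edgeSet he
    exact ⟨⟨u, h.left_mem⟩, ⟨v, h.right_mem⟩, h⟩
  choose p q hpq using hex
  -- Absence of self-loops makes the map to simple edges well defined; absence of parallel edges
  -- makes it injective.
  refine Set.ncard_congr (fun e he => s(p e he, q e he)) (fun e he => ?_)
    (fun e e' he he' h => ?_) (fun s hs => ?_)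
  · have hne : p e he ≠ q e he := fun h => by
      have := hpq e he
      rw [h] at this
      exact ha.not_isLink_self _ _ this
    simpa [Graph.toSimpleGraph, hne] using (hpq e he).adj
  · refine ha.eq_of_isLink (hpq e he) ?_
    rcases Sym2.eq_iff.1 h with ⟨h1, h2⟩ | ⟨h1, h2⟩
    · rw [h1, h2]
      exact hpq e' he'
    · rw [h1, h2]
      exact (hpq e' he').symm
  · induction s using Sym2.ind with
    | _ u v =>
      obtain ⟨-, e, he⟩ : u ≠ v ∧ H.Adj u v := by simpa [Graph.toSimpleGraph] using hs
      refine ⟨e, he.edge_mem, Sym2.eq_iff.2 ?_⟩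
      rcases (hpq e he.edge_mem).eq_and_eq_or_eq_and_eq he with ⟨h1, h2⟩ | ⟨h1, h2⟩
      · exact .inl ⟨Subtype.ext h1, Subtype.ext h2⟩
      · exact .inr ⟨Subtype.ext h1, Subtype.ext h2⟩

theorem IsSpanningTree.ncard_add_one {G : Graph α β} {T : Set β} (hV : V(G).Finite)
    (hT : IsSpanningTree G T) : T.ncard + 1 = V(G).ncard := by
  have := ncard_edgeSet_add_one (H := G.restrict T) hV hT.2.1 hT.2.2
  rwa [Graph.edgeSet_restrict, Set.inter_eq_right.2 hT.1] at this

/-- Removing an edge whose ends remain joined preserves connectedness. -/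
theorem IsConnectedGraph.deleteEdges {H : Graph α β} (hc : IsConnectedGraph H) {e : β} {u v : α}
    (he : H.IsLink e u v) (h : Relation.ReflTransGen (H.deleteEdges {e}).Adj u v) :
    IsConnectedGraph (H.deleteEdges {e}) := by
  have : Std.Symm (H.deleteEdges {e}).Adj := ⟨fun _ _ h => h.symm⟩
  have hsymm : Relation.ReflTransGen (H.deleteEdges {e}).Adj v u := Std.Symm.symm _ _ h
  refine ⟨hc.1, fun x hx y hy => ?_⟩
  have hxy := hc.2 x hx y hy
  clear hx hy
  induction hxy with
  | refl => exact .refl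
  | tail _ hadj ih =>
    obtain ⟨e', he'⟩ := hadj
    refine ih.trans ?_
    by_cases hee : e' = e
    · subst hee
      rcases he'.eq_and_eq_or_eq_and_eq he with ⟨rfl, rfl⟩ | ⟨rfl, rfl⟩
      · exact h
      · exact hsymm
    · exact .single ⟨e', by simpa [he'] using hee⟩

/-- A minimal edge set that keeps all vertices connected is acyclic: an edge on a cycle could be
deleted. -/
theorem IsFeynmanGraph.exists_isSpanningTree {G : Graph α β} (hG : IsFeynmanGraph G) :
    ∃ T, IsSpanningTree G T := by
  obtain ⟨-, hE, hc⟩ := hG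
  have hfin : {T : Set β | T ⊆ E(G) ∧ IsConnectedGraph (G.restrict T)}.Finite :=
    hE.finite_subsets.subset fun T hT => hT.1
  obtain ⟨T, hT⟩ := hfin.exists_minimal ⟨E(G), subset_rfl, by rwa [Graph.restrict_self]⟩
  refine ⟨T, hT.prop.1, hT.prop.2, fun e u v he hr => ?_⟩
  have hdel := hT.prop.2.deleteEdges he hr
  have heq : (G.restrict T).deleteEdges {e} = G.restrict (T \ {e}) := by
    refine Graph.ext rfl fun e' x y => ?_
    simp only [Graph.restrict_isLink, Graph.deleteEdges_isLink, Set.mem_sdiff]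
    tauto
  rw [heq] at hdel
  have hle := hT.le_of_le ⟨Set.sdiff_subset.trans hT.prop.1, hdel⟩ Set.sdiff_subset
  exact (hle he.1).2 rfl

/-! ### One-loop graphs and banana graphs -/

theorem affineIndependent_indicator_singleton (I : Finset β) :
    AffineIndependent ℤ fun (e : I) => Set.indicator {(e : β)} (1 : β → ℤ) := by
  classical
  rw [affineIndependent_iff]
  intro s w _ h e he
  have := congrFun h e
  simpa [Finset.sum_apply, Pi.single_apply, Subtype.coe_inj, he] using this

/-- The weights sum to zero, so the common vector of `I` cancels and only the unit vectors remain.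
-/
theorem affineIndependent_indicator_diff_singleton (I : Finset β) :
    AffineIndependent ℤ fun (e : I) => Set.indicator ((I : Set β) \ {(e : β)}) (1 : β → ℤ) := by
  classical
  rw [affineIndependent_iff]
  intro s w hw h e he
  have h1 := congrFun h e
  have h2 : ∀ x : I, w x * Set.indicator ((I : Set β) \ {(x : β)}) (1 : β → ℤ) e =
      w x - if e = x then w x else 0 := fun x => by
    by_cases hx : e = x <;> simp [hx]
  simp only [Finset.sum_apply, Pi.smul_apply, smul_eq_mul, h2, Finset.sum_sub_distrib, hw,
    Finset.sum_ite_eq, he, if_true, Pi.zero_apply] at h1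
  linarith

theorem principalADetEqOne_of_loopNumber_eq_one [Fintype β] {G : Graph α β} (hG : IsFeynmanGraph G)
    (hL : loopNumber G = 1) : PrincipalADetEqOne (firstSymanzik G) := by
  classical
  have hcard : E(G).ncard = V(G).ncard := by
    unfold loopNumber at hL
    omega
  have hex : ∀ T, IsSpanningTree G T → ∃ e ∈ E(G), E(G) \ {e} = T := by
    intro T hT
    have h1 := hT.ncard_add_one hG.1
    have h2 := Set.ncard_sdiff_add_ncard_of_subset hT.1 hG.2.1
    obtain ⟨e, he⟩ := Set.ncard_eq_one.1 (show (E(G) \ T).ncard = 1 by omega)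
    refine ⟨e, ((Set.ext_iff.1 he e).2 rfl).1, ?_⟩
    rw [← he, Set.sdiff_sdiff_cancel_left hT.1]
  -- The edges of the unique cycle; bridges are excluded.
  let I : Finset β := {e | e ∈ E(G) ∧ IsSpanningTree G (E(G) \ {e})}
  let T : β → Finset β := fun e => (E(G) \ {e}).toFinset
  refine principalADetEqOne_firstSymanzik G I ?_ T (fun F => ⟨fun hF => ?_, ?_⟩) ?_
  · obtain ⟨T₀, hT₀⟩ := hG.exists_isSpanningTree
    obtain ⟨e, he, rfl⟩ := hex _ hT₀
    exact ⟨e, by simp [I, he, hT₀]⟩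
  · obtain ⟨e, he, heF⟩ := hex _ hF
    refine ⟨e, by simp [I, he, heF, hF], ?_⟩
    rw [← Finset.coe_inj, Set.coe_toFinset, heF]
  · rintro ⟨e, he, rfl⟩
    rw [Set.coe_toFinset]
    exact (Finset.mem_filter.1 he).2.2
  · convert affineIndependent_indicator_singleton I using 3 with e
    have he : (e : β) ∈ E(G) := (Finset.mem_filter.1 e.2).2.1
    ext x
    simp only [T, Set.mem_toFinset, Set.mem_sdiff, Set.mem_singleton_iff, Set.mem_ofPred_eq]
    constructor
    · rintro ⟨h1, h2⟩
      by_contra hx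
      exact h2 ⟨h1, hx⟩
    · rintro rfl
      exact ⟨he, fun h => h.2 rfl⟩

theorem isSpanningTree_banana_iff {u v : α} (huv : u ≠ v) (S T : Set β) :
    IsSpanningTree (Graph.banana u v S) T ↔ ∃ e ∈ S, {e} = T := by
  constructor
  · rintro ⟨hTS, hc, ha⟩
    have hr := hc.2 u (by simp) v (by simp)
    -- The first step of a path from `u` to `v` supplies an edge of `T`; a second one would be
    -- parallel to it, against acyclicity.
    obtain rfl | ⟨w, ⟨e, he⟩, -⟩ := hr.cases_head
    · exact (huv rfl).elim
    have heT : e ∈ T := he.1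
    refine ⟨e, hTS heT, (Set.eq_singleton_iff_unique_mem.2 ⟨heT, fun e' he' => ?_⟩).symm⟩
    have hlink : ∀ x ∈ T, ((Graph.banana u v S).restrict T).IsLink x u v := fun x hx =>
      ⟨hx, hTS hx, .inl ⟨rfl, rfl⟩⟩
    exact ha.eq_of_isLink (hlink e' he') (hlink e heT)
  · rintro ⟨e, he, rfl⟩
    have hadj : ((Graph.banana u v S).restrict {e}).Adj u v := ⟨e, rfl, he, .inl ⟨rfl, rfl⟩⟩
    refine ⟨by simpa using he, ⟨⟨u, by simp⟩, ?_⟩, ?_⟩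
    · rintro x (rfl | rfl) y (rfl | rfl)
      · exact .refl
      · exact .single hadj
      · exact .single hadj.symm
      · exact .refl
    · rintro e' x y ⟨rfl, -, hxy⟩ hr
      obtain rfl | ⟨w, ⟨e'', he''⟩, -⟩ := hr.cases_head
      · rcases hxy with ⟨h1, h2⟩ | ⟨h1, h2⟩
        · exact huv (h1.symm.trans h2)
        · exact huv (h2.symm.trans h1)
      · rw [Graph.deleteEdges_isLink] at he''
        exact he''.2 he''.1.1

theorem principalADetEqOne_banana [Fintype β] {u v : α} (huv : u ≠ v) {S : Set β}
    (hS : S.Nonempty) : PrincipalADetEqOne (firstSymanzik (Graph.banana u v S)) := by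
  classical
  refine principalADetEqOne_firstSymanzik _ S.toFinset (by simpa using hS) (fun e => {e})
    (fun F => ?_) ?_
  · rw [isSpanningTree_banana_iff huv]
    simp only [Set.mem_toFinset, ← Finset.coe_singleton, Finset.coe_inj]
  · convert affineIndependent_indicator_diff_singleton S.toFinset using 3 with e
    ext x
    simp

end

end

theorem mainTheorem7 {α β : Type*} [Fintype β] :
    (∀ G : Graph α β, IsFeynmanGraph G → loopNumber G = 1 →
      PrincipalADetEqOne (firstSymanzik G)) ∧
    (∀ (L : ℕ) (u v : α) (S : Set β), u ≠ v → S.ncard = L + 1 →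
      PrincipalADetEqOne (firstSymanzik (Graph.banana u v S))) :=
  ⟨fun _ hG hL => principalADetEqOne_of_loopNumber_eq_one hG hL,
    fun L _ _ _ huv hS => principalADetEqOne_banana huv
      (Set.nonempty_of_ncard_ne_zero (hS.trans_ne (Nat.succ_ne_zero L)))⟩
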